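/- Let $0<\alpha<2$. For a measure space $(S,\mu)$ and $\{f_t\}_{t\in T}\subset L^\alpha(S,\mu)$, a process $\{X_t\}_{t\in T}$ has the representation $\{X_t\}\stackrel{d}{=}\{\int_S f_t\,dM_{\alpha,+}\}$ ($M_{\alpha,+}$ a symmetric $\alpha$-stable, S$\alpha$S, random measure with control measure $\mu$) if $$\mathbb E\exp\Big(-i\sum_{j=1}^n a_jX_{t_j}\Big)=\exp\Big(-\int_S\Big|\sum_{j=1}^n a_jf_{t_j}\Big|^\alpha d\mu\Big)\qquad(n\in\mathbb N,\ a_j\in\mathbb R,\ t_j\in T).$$ For nonnegative $f_t\in L^\alpha(S,\mu)$, a nonnegative process $\{Y_t\}_{t\in T}$ is an $\alpha$-Fréchet process with the extremal integral representation by $\{f_t\}$ if $$\mathbb P(Y_{t_1}\le a_1,\dots,Y_{t_n}\le a_n)=\exp\Big(-\int_S\Big(\max_{1\le j\le n} f_{t_j}/a_j\Big)^\alpha d\mu\Big)\qquad(n\ge1,\ a_j>0,\ t_j\in T).$$ An S$\alpha$S process $X$ is max-associable if there are a $\sigma$-finite measure space $(S,\mu)$, nonnegative $\{f_t\}\subset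 L^\alpha(S,\mu)$ and an $\alpha$-Fréchet process $Y$ such that $X$ and $Y$ have the stable and the extremal integral representation, respectively, by the same functions $\{f_t\}$. **Proposition 4.3.** Let $E$ be a metric space whose Borel $\sigma$-field is standard Borel, with a $\sigma$-finite Borel measure $\nu$ such that $\nu(U)>0$ for every nonempty open $U\subset E$, and let $m(dx,du)=\nu(dx)\,du$ on $E\times\mathbb R$. Let $G:E\times\mathbb R\to\mathbb R$ be measurable with $G_t(x,u)=G(x,t+u)-G(x,u)$ in $L^\alpha(E\times\mathbb R,m)$ for every $t\in\mathbb R$, and let $\{X_t\}_{t\in\mathbb R}$ be the mixed moving average with stationary increments $$\{X_t\}_{t\in\mathbb R}\stackrel{d}{=}\Big\{\int_E\int_{\mathbb R}\big(G(x,t+u)-G(x,u)\big)\,M_{\alpha,+}(dx,du)\Big\}_{t\in\mathbb R},$$ where $M_{\alpha,+}$ has control measure $m$. Suppose there is a set $\mathcal N\subset E\times\mathbb R$, closed in the product topology, with $m(\mathcal N)=0$, such that $G$ is continuous at every point of $\mathcal N^c=(E\times\mathbb R)\setminus\mathcal N$. Then $X$ is max-associable if and only if there are functions $f,c:E\to\mathbb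 R$ and sets $A_x\subset\mathbb R$ $(x\in E)$ such that $$G(x,u)=f(x)\mathbf 1_{A_x}(u)+c(x)\qquad\text{for all }(x,u)\in\mathcal N^c.$$ Consequently, the following processes are not max-associable. (i) Linear fractional stable motions $$\{X_t\}_{t\in\mathbb R}\stackrel{d}{=}\Big\{\int_{\mathbb R}\Big(a\big((t+u)_+^{H-1/\alpha}-u_+^{H-1/\alpha}\big)+b\big((t+u)_-^{H-1/\alpha}-u_-^{H-1/\alpha}\big)\Big)M_{\alpha,+}(du)\Big\}_{t\in\mathbb R},$$ where $H\in(0,1)$, $H\ne1/\alpha$, $a,b\in\mathbb R$, $|a|+|b|>0$, the control measure is Lebesgue measure, and $0^{H-1/\alpha}:=0$. (ii) Telecom processes $$\{X_t\}_{t\in\mathbb R}\stackrel{d}{=}\Big\{\int_{\mathbb R}\int_{\mathbb R}e^{-(H-1/\alpha)s}\big(F(e^s(t+u))-F(e^su)\big)\,M_{\alpha,+}(ds,du)\Big\}_{t\in\mathbb R},\qquad F(z)=(\min(z,0)+1)_+,$$ where $1<\alpha<2$, $1/\alpha<H<1$, and the control measure is $ds\,du$. -/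

import Mathlib

open MeasureTheory Set

universe u v w

/-- `X` has the stable integral representation `{X_t} =ᵈ {∫_S f_t dM_{α,+}}`, where `M_{α,+}` is a
symmetric `α`-stable random measure with control measure `μ`. Stable integrals are given by their
finite-dimensional distributions: every spectral function `f_t` lies in `L^α(S, μ)` and
`E exp(-i ∑ a_j X_{t_j}) = exp(-∫_S |∑ a_j f_{t_j}|^α dμ)` for all finite linear combinations. -/
structure HasStableRep {T Ω S : Type*} [MeasurableSpace Ω] [MeasurableSpace S] (α : ℝ)
    (P : Measure Ω) (X : T → Ω → ℝ) (μ : Measure S) (f : T → S → ℝ) : Prop where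
  memLp : ∀ t, MemLp (f t) (ENNReal.ofReal α) μ
  measurable : ∀ t, Measurable (X t)
  charFun_eq : ∀ (s : Finset T) (a : T → ℝ),
    ∫ ω, Complex.exp (-(Complex.I * ((∑ t ∈ s, a t * X t ω : ℝ) : ℂ))) ∂P =
      ((Real.exp (-∫ x, |∑ t ∈ s, a t * f t x| ^ α ∂μ) : ℝ) : ℂ)

/-- `Y` has the extremal integral representation `{Y_t} =ᵈ {∫ᵉ_S f_t dM_{α,∨}}`, where `M_{α,∨}` is
an `α`-Fréchet random sup-measure with control measure `μ`. Extremal integrals are given by their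
finite-dimensional distributions: every `f_t` lies in `L^α_+(S, μ)`, the variables `Y_t` are
nonnegative, and `P(Y_{t_1} ≤ a_1, …, Y_{t_n} ≤ a_n) = exp(-∫_S (max_j f_{t_j} / a_j)^α dμ)` for
all `a_j > 0`. -/
structure HasExtremalRep {T Ω S : Type*} [MeasurableSpace Ω] [MeasurableSpace S] (α : ℝ)
    (P : Measure Ω) (Y : T → Ω → ℝ) (μ : Measure S) (f : T → S → ℝ) : Prop where
  memLp : ∀ t, MemLp (f t) (ENNReal.ofReal α) μ
  nonneg : ∀ t, 0 ≤ᵐ[μ] f t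
  measurable : ∀ t, Measurable (Y t)
  process_nonneg : ∀ t, ∀ᵐ ω ∂P, 0 ≤ Y t ω
  cdf_eq : ∀ (s : Finset T) (hs : s.Nonempty) (a : T → ℝ), (∀ t ∈ s, 0 < a t) →
    P.real {ω | ∀ t ∈ s, Y t ω ≤ a t} =
      Real.exp (-∫ x, (s.sup' hs fun t => f t x / a t) ^ α ∂μ)

/-- The processes `X` and `Y` are associated by the nonnegative spectral functions
`f_t ∈ L^α_+(S, μ)`. -/
def AssociatedBy {T Ω Ω' S : Type*} [MeasurableSpace Ω] [MeasurableSpace Ω'] [MeasurableSpace S]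
    (α : ℝ) (P : Measure Ω) (X : T → Ω → ℝ) (P' : Measure Ω') (Y : T → Ω' → ℝ)
    (μ : Measure S) (f : T → S → ℝ) : Prop :=
  HasStableRep α P X μ f ∧ HasExtremalRep α P' Y μ f

/-- The process `X` is max-associable: some `α`-Fréchet process `Y` (possibly on another
probability space) is associated with `X`, through nonnegative spectral functions on some
`σ`-finite measure space. -/
def MaxAssociable {T Ω : Type*} [MeasurableSpace Ω] (α : ℝ) (P : Measure Ω)
    (X : T → Ω → ℝ) : Prop :=
  ∃ (Ω' : Type v) (_ : MeasurableSpace Ω') (P' : Measure Ω') (_ : IsProbabilityMeasure P')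
    (Y : T → Ω' → ℝ)
    (S : Type v) (_ : MeasurableSpace S) (μ : Measure S) (_ : SigmaFinite μ) (f : T → S → ℝ),
    AssociatedBy α P X P' Y μ f

/-- The spectral functions `G_t(x, u) = G(x, t + u) - G(x, u)` of a mixed moving average with
stationary increments. -/
def incrementKernel {E : Type*} (G : E → ℝ → ℝ) (t : ℝ) (p : E × ℝ) : ℝ :=
  G p.1 (t + p.2) - G p.1 p.2

/-- The spectral functions of the linear fractional stable motion on the real line,
`a ((t+u)_+^{H-1/α} - u_+^{H-1/α}) + b ((t+u)_-^{H-1/α} - u_-^{H-1/α})`. For a nonzero exponent,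
`0 ^ (H - 1 / α)` is `0`, which is the usual convention. -/
noncomputable def lfsmKernel (α H a b t u : ℝ) : ℝ :=
  a * ((max (t + u) 0) ^ (H - 1 / α) - (max u 0) ^ (H - 1 / α)) +
    b * ((max (-(t + u)) 0) ^ (H - 1 / α) - (max (-u) 0) ^ (H - 1 / α))

/-- The function `F(z) = (min(z, 0) + 1)_+`. -/
noncomputable def telecomF (z : ℝ) : ℝ := max (min z 0 + 1) 0

/-- The spectral functions of the Telecom process on `ℝ × ℝ ∋ (s, u)`,
`e^{-(H - 1/α) s} (F(e^s (t + u)) - F(e^s u))`. -/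
noncomputable def telecomKernel (α H t : ℝ) (p : ℝ × ℝ) : ℝ :=
  Real.exp (-(H - 1 / α) * p.1) *
    (telecomF (Real.exp p.1 * (t + p.2)) - telecomF (Real.exp p.1 * p.2))

/-! Everything rests on one criterion: `X` is max-associable exactly when any two of its spectral
functions satisfy `g_s g_t ≥ 0` a.e.

Necessity: the law of `X` fixes the integrals `∫ |a g_s + b g_t|^α`, and these determine which
quadrants the Lévy measure of `(X_s, X_t)` charges. That measure may be infinite, so it is damped by
`1 - cos` of the first coordinate. The result is finite, and its Fourier transform involves only
those integrals, so it is the same for every representation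
(`ae_mul_nonneg_of_integral_abs_rpow_eq`). Sufficiency: under a common sign the functions `|g_t|`
also represent `X`, and a Poisson construction makes an `α`-Fréchet process from them
(`exists_hasExtremalRep`).

If `G(x, ·)` has three values off `N`, start at a point with the middle value: the increments to the
other two points have opposite signs, by continuity on an open set, which has positive measure. With
only two values, all increments from a given point share a sign. Both examples fall to the same
choice of base point. -/

/-! ### The cosine weight and its Fourier transform. -/

/-- The weight `(1 - cos (r ξ)) |r|^{-1-α}`, whose integral over `r` is a multiple of `|ξ|^α`. -/
noncomputable def cosWeight (α ξ r : ℝ) : ℝ := (1 - Real.cos (r * ξ)) * |r| ^ (-1 - α)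

theorem cosWeight_nonneg (α ξ r : ℝ) : 0 ≤ cosWeight α ξ r :=
  mul_nonneg (sub_nonneg.2 (Real.cos_le_one _)) (Real.rpow_nonneg (abs_nonneg _) _)

theorem cosWeight_neg_right (α ξ r : ℝ) : cosWeight α ξ (-r) = cosWeight α ξ r := by
  simp [cosWeight]

theorem Measurable.cosWeight {T : Type*} [MeasurableSpace T] {ξ r : T → ℝ} (α : ℝ)
    (hξ : Measurable ξ) (hr : Measurable r) : Measurable fun q => cosWeight α (ξ q) (r q) := by
  unfold _root_.cosWeight; fun_prop

/-- Near `0` the weight is at most `r ^ (1 - α)`, integrable as `α < 2`; at infinity it is at most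
`2 r ^ (-1 - α)`, integrable as `0 < α`. -/
theorem integrable_cosWeight_one {α : ℝ} (hα0 : 0 < α) (hα2 : α < 2) :
    Integrable (cosWeight α 1) := by
  have hm : Measurable (cosWeight α 1) := by unfold cosWeight; fun_prop
  have h1 : IntegrableOn (cosWeight α 1) (Ioc 0 1) := by
    have hi : IntegrableOn (fun r : ℝ => r ^ (1 - α)) (Ioc 0 1) := by
      have := intervalIntegral.intervalIntegrable_rpow' (a := 0) (b := 1) (r := 1 - α)
        (by linarith)
      rwa [intervalIntegrable_iff_integrableOn_Ioc_of_le zero_le_one] at this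
    refine Integrable.mono' hi hm.aestronglyMeasurable ?_
    filter_upwards [ae_restrict_mem measurableSet_Ioc] with r hr
    rw [Real.norm_of_nonneg (cosWeight_nonneg _ _ _), cosWeight, abs_of_pos hr.1, mul_one]
    have hc : 1 - Real.cos r ≤ r ^ (2 : ℝ) := by
      have := Real.one_sub_sq_div_two_le_cos (x := r)
      rw [Real.rpow_two]; nlinarith [sq_nonneg r]
    calc _ ≤ r ^ (2 : ℝ) * r ^ (-1 - α) :=
          mul_le_mul_of_nonneg_right hc (Real.rpow_nonneg hr.1.le _)
      _ = r ^ (1 - α) := by rw [← Real.rpow_add hr.1]; congr 1; ring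
  have h2 : IntegrableOn (cosWeight α 1) (Ioi 1) := by
    have hi : IntegrableOn (fun r : ℝ => 2 * r ^ (-1 - α)) (Ioi 1) :=
      (integrableOn_Ioi_rpow_of_lt (by linarith) one_pos).const_mul 2
    refine Integrable.mono' hi hm.aestronglyMeasurable ?_
    filter_upwards [ae_restrict_mem measurableSet_Ioi] with r hr
    have hr0 : (0 : ℝ) < r := one_pos.trans hr
    rw [Real.norm_of_nonneg (cosWeight_nonneg _ _ _), cosWeight, abs_of_pos hr0]
    have := Real.neg_one_le_cos (r * 1)
    exact mul_le_mul_of_nonneg_right (by linarith) (Real.rpow_nonneg hr0.le _)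
  have h3 : IntegrableOn (cosWeight α 1) (Ioi 0) := by
    rw [← Ioc_union_Ioi_eq_Ioi zero_le_one]; exact h1.union h2
  have h4 : IntegrableOn (cosWeight α 1) (Iic 0) := by
    have := ((Measure.measurePreserving_neg (volume : Measure ℝ)).integrableOn_comp_preimage
      (Homeomorph.neg ℝ).measurableEmbedding (f := cosWeight α 1) (s := Ioi 0)).2 h3
    rw [integrableOn_Iic_iff_integrableOn_Iio]
    have e : cosWeight α 1 ∘ Neg.neg = cosWeight α 1 := funext fun r => cosWeight_neg_right α 1 r
    have e' : (Neg.neg ⁻¹' Ioi 0 : Set ℝ) = Iio 0 := by ext r; simp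
    rwa [← e, ← e']
  rw [← integrableOn_univ, ← Iic_union_Ioi (a := (0 : ℝ))]
  exact h4.union h3

theorem cosWeight_eq_mul {α ξ : ℝ} (hξ : ξ ≠ 0) (r : ℝ) :
    cosWeight α ξ r = |ξ| ^ (1 + α) * cosWeight α 1 (r * ξ) := by
  have h : |ξ| ^ (1 + α) * |ξ| ^ (-1 - α) = 1 := by
    rw [← Real.rpow_add (abs_pos.2 hξ)]; simp
  rw [cosWeight, cosWeight, abs_mul, Real.mul_rpow (abs_nonneg _) (abs_nonneg _), mul_one]
  linear_combination -((1 - Real.cos (r * ξ)) * |r| ^ (-1 - α)) * h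

theorem integrable_cosWeight {α : ℝ} (hα0 : 0 < α) (hα2 : α < 2) (ξ : ℝ) :
    Integrable (cosWeight α ξ) := by
  rcases eq_or_ne ξ 0 with rfl | hξ
  · have : cosWeight α 0 = 0 := by ext; simp [cosWeight]
    rw [this]; exact integrable_zero _ _ _
  · rw [show cosWeight α ξ = fun r => |ξ| ^ (1 + α) * cosWeight α 1 (r * ξ) from
      funext (cosWeight_eq_mul hξ)]
    exact ((integrable_cosWeight_one hα0 hα2).comp_mul_right' hξ).const_mul _

theorem integral_cosWeight {α : ℝ} (hα0 : 0 < α) (ξ : ℝ) :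
    ∫ r, cosWeight α ξ r = (∫ r, cosWeight α 1 r) * |ξ| ^ α := by
  rcases eq_or_ne ξ 0 with rfl | hξ
  · simp [cosWeight, Real.zero_rpow hα0.ne']
  · simp_rw [cosWeight_eq_mul hξ, integral_const_mul]
    rw [Measure.integral_comp_mul_right (cosWeight α 1), smul_eq_mul, abs_inv,
      Real.rpow_add (abs_pos.2 hξ), Real.rpow_one]
    have := abs_pos.2 hξ
    field_simp

theorem integral_cosWeight_one_pos {α : ℝ} (hα0 : 0 < α) (hα2 : α < 2) :
    0 < ∫ r, cosWeight α 1 r := by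
  rw [integral_pos_iff_support_of_nonneg (cosWeight_nonneg α 1) (integrable_cosWeight_one hα0 hα2)]
  have hs : Ioo (0 : ℝ) 1 ⊆ Function.support (cosWeight α 1) := by
    intro r hr
    have h1 : Real.cos r < 1 := by
      rw [← Real.cos_zero]
      exact Real.cos_lt_cos_of_nonneg_of_le_pi le_rfl (by linarith [Real.pi_gt_three, hr.2]) hr.1
    rw [Function.mem_support, cosWeight, mul_one]
    exact (mul_pos (by linarith) (Real.rpow_pos_of_pos (abs_pos.2 hr.1.ne') _)).ne'
  exact lt_of_lt_of_le (by simp) (measure_mono hs)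

/-- The Fourier transform of the weight `cosWeight α ξ`. -/
theorem integral_cosWeight_mul_exp {α : ℝ} (hα0 : 0 < α) (hα2 : α < 2) (ξ η : ℝ) :
    ∫ r, (cosWeight α ξ r : ℂ) * Complex.exp ((r * η : ℝ) * Complex.I) =
      (((∫ r, cosWeight α 1 r) / 2 * (|η + ξ| ^ α + |η - ξ| ^ α - 2 * |η| ^ α) : ℝ) : ℂ) := by
  have hint := integrable_cosWeight hα0 hα2
  have hi : Integrable fun r => (cosWeight α ξ r : ℂ) * Complex.exp ((r * η : ℝ) * Complex.I) := by
    refine (hint ξ).ofReal.mul_bdd (c := 1) (by fun_prop) (ae_of_all _ fun r => ?_)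
    rw [Complex.norm_exp_ofReal_mul_I]
  -- The weight is even, so pairing `r` with `-r` leaves a cosine. The product formula then gives a
  -- combination of weights, each of which is integrable.
  have h1 : ∀ r : ℝ, (cosWeight α ξ r : ℂ) * Complex.exp ((r * η : ℝ) * Complex.I) +
      (cosWeight α ξ (-r) : ℂ) * Complex.exp ((-r * η : ℝ) * Complex.I) =
      ((cosWeight α (η + ξ) r + cosWeight α (η - ξ) r - 2 * cosWeight α η r : ℝ) : ℂ) := by
    intro r
    have e : Complex.exp ((r * η : ℝ) * Complex.I) + Complex.exp ((-r * η : ℝ) * Complex.I) =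
        ((2 * Real.cos (r * η) : ℝ) : ℂ) := by
      rw [Complex.exp_mul_I, Complex.exp_mul_I]
      push_cast
      rw [neg_mul, Complex.cos_neg, Complex.sin_neg]; ring
    rw [cosWeight_neg_right, ← mul_add, e, ← Complex.ofReal_mul]
    congr 1
    simp only [cosWeight, mul_add, mul_sub, Real.cos_add, Real.cos_sub]
    ring
  have h2 := integral_neg_eq_self
    (fun r : ℝ => (cosWeight α ξ r : ℂ) * Complex.exp ((r * η : ℝ) * Complex.I)) volume
  have h3 := integral_add hi hi.comp_neg
  simp only [h1, h2] at h3
  rw [integral_complex_ofReal, 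
    integral_sub (f := fun r => cosWeight α (η + ξ) r + cosWeight α (η - ξ) r)
      ((hint _).add (hint _)) ((hint _).const_mul _),
    integral_add (hint _) (hint _), integral_const_mul, integral_cosWeight hα0 (η + ξ),
    integral_cosWeight hα0 (η - ξ), integral_cosWeight hα0 η] at h3
  rw [← two_mul] at h3
  apply mul_left_cancel₀ (two_ne_zero (α := ℂ))
  rw [← h3, ← Complex.ofReal_ofNat, ← Complex.ofReal_mul]
  congr 1; ring

/-! ### The damped Lévy measure of a pair of spectral functions. -/

section PairMeasure

variable {S : Type*} [MeasurableSpace S] {μ : Measure S} {F G : S → ℝ} {α : ℝ}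

theorem integrable_abs_rpow_of_memLp (hα0 : 0 < α) (hF : MemLp F (ENNReal.ofReal α) μ) :
    Integrable (fun x => |F x| ^ α) μ := by
  have := hF.integrable_norm_rpow (by simpa using hα0) ENNReal.ofReal_ne_top
  simpa [ENNReal.toReal_ofReal hα0.le] using this

theorem integrable_abs_add_rpow (hα0 : 0 < α) (hF : MemLp F (ENNReal.ofReal α) μ)
    (hG : MemLp G (ENNReal.ofReal α) μ) (a b : ℝ) :
    Integrable (fun x => |a * F x + b * G x| ^ α) μ :=
  integrable_abs_rpow_of_memLp hα0 ((hF.const_mul a).add (hG.const_mul b))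

/-- The image of the measure `(1 - cos (r F(x))) |r|^{-1-α} dr μ(dx)` under
`(x, r) ↦ (r F(x), r G(x))`: the Lévy measure of a symmetric stable vector with spectral functions
`F` and `G`, damped to be finite. -/
noncomputable def dampedLevy (α : ℝ) (μ : Measure S) (F G : S → ℝ) : Measure (ℝ × ℝ) :=
  ((μ.prod volume).withDensity fun q => ENNReal.ofReal (cosWeight α (F q.1) q.2)).map
    fun q => (q.2 * F q.1, q.2 * G q.1)

theorem integrable_cosWeight_prod [SFinite μ] (hα0 : 0 < α) (hα2 : α < 2) (hFm : Measurable F)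
    (hF : MemLp F (ENNReal.ofReal α) μ) :
    Integrable (fun q : S × ℝ => cosWeight α (F q.1) q.2) (μ.prod volume) := by
  have hm : Measurable fun q : S × ℝ => cosWeight α (F q.1) q.2 :=
    (hFm.comp measurable_fst).cosWeight α measurable_snd
  rw [integrable_prod_iff hm.aestronglyMeasurable]
  refine ⟨ae_of_all _ fun x => integrable_cosWeight hα0 hα2 (F x), ?_⟩
  simp_rw [Real.norm_of_nonneg (cosWeight_nonneg _ _ _)]
  exact ((integrable_abs_rpow_of_memLp hα0 hF).const_mul _).congr
    (ae_of_all _ fun x => (integral_cosWeight hα0 (F x)).symm)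

theorem isFiniteMeasure_dampedLevy [SFinite μ] (hα0 : 0 < α) (hα2 : α < 2) (hFm : Measurable F)
    (hF : MemLp F (ENNReal.ofReal α) μ) : IsFiniteMeasure (dampedLevy α μ F G) := by
  have := isFiniteMeasure_withDensity_ofReal
    (integrable_cosWeight_prod hα0 hα2 hFm hF).hasFiniteIntegral
  unfold dampedLevy
  infer_instance

/-- Fubini with the inner integral over `r`: the Fourier transform of the weight is applied with `ξ
= F x` and `η = L (F x, G x)`. -/
theorem charFunDual_dampedLevy [SFinite μ] (hα0 : 0 < α) (hα2 : α < 2) (hFm : Measurable F)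
    (hGm : Measurable G) (hF : MemLp F (ENNReal.ofReal α) μ) (hG : MemLp G (ENNReal.ofReal α) μ)
    (L : StrongDual ℝ (ℝ × ℝ)) :
    charFunDual (dampedLevy α μ F G) L = (((∫ r, cosWeight α 1 r) / 2 *
      ((∫ x, |(L (1, 0) + 1) * F x + L (0, 1) * G x| ^ α ∂μ) +
        (∫ x, |(L (1, 0) - 1) * F x + L (0, 1) * G x| ^ α ∂μ) -
        2 * ∫ x, |L (1, 0) * F x + L (0, 1) * G x| ^ α ∂μ) : ℝ) : ℂ) := by
  have hL : ∀ y z : ℝ, L (y, z) = y * L (1, 0) + z * L (0, 1) := by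
    intro y z
    rw [← smul_eq_mul, ← smul_eq_mul, ← map_smul, ← map_smul, ← map_add]
    simp
  have hw := integrable_cosWeight_prod hα0 hα2 hFm hF
  have hm : Measurable fun q : S × ℝ => cosWeight α (F q.1) q.2 :=
    (hFm.comp measurable_fst).cosWeight α measurable_snd
  rw [charFunDual_apply, dampedLevy, integral_map (by fun_prop) (by fun_prop),
    integral_withDensity_eq_integral_toReal_smul (by fun_prop) (by simp)]
  have e : ∀ q : S × ℝ, (ENNReal.ofReal (cosWeight α (F q.1) q.2)).toReal •
      Complex.exp ((L (q.2 * F q.1, q.2 * G q.1) : ℂ) * Complex.I) =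
      (cosWeight α (F q.1) q.2 : ℂ) *
        Complex.exp ((q.2 * (L (1, 0) * F q.1 + L (0, 1) * G q.1) : ℝ) * Complex.I) := by
    intro q
    rw [ENNReal.toReal_ofReal (cosWeight_nonneg _ _ _), hL, Complex.real_smul]
    congr 4; ring
  simp_rw [e]
  rw [integral_prod]
  · simp_rw [integral_cosWeight_mul_exp hα0 hα2]
    rw [integral_complex_ofReal, integral_const_mul]
    have hi := integrable_abs_add_rpow hα0 hF hG
    have e1 : ∀ x, L (1, 0) * F x + L (0, 1) * G x + F x =
      (L (1, 0) + 1) * F x + L (0, 1) * G x := fun x => by ring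
    have e2 : ∀ x, L (1, 0) * F x + L (0, 1) * G x - F x =
      (L (1, 0) - 1) * F x + L (0, 1) * G x := fun x => by ring
    simp_rw [e1, e2]
    rw [integral_sub (f := fun x => |(L (1, 0) + 1) * F x + L (0, 1) * G x| ^ α +
        |(L (1, 0) - 1) * F x + L (0, 1) * G x| ^ α) ((hi _ _).add (hi _ _))
        ((hi _ _).const_mul _), integral_add (hi _ _) (hi _ _), integral_const_mul]
  · refine hw.ofReal.mul_bdd (c := 1) (by fun_prop) (ae_of_all _ fun q => ?_)
    rw [Complex.norm_exp_ofReal_mul_I]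

/-- The damped Lévy measure charges the open second and fourth quadrants unless `F G ≥ 0`. -/
theorem dampedLevy_quadrants_eq_zero_iff [SFinite μ] (hα0 : 0 < α) (hα2 : α < 2)
    (hFm : Measurable F) (hGm : Measurable G) :
    dampedLevy α μ F G {z | z.1 * z.2 < 0} = 0 ↔ ∀ᵐ x ∂μ, 0 ≤ F x * G x := by
  have hm : Measurable fun q : S × ℝ => cosWeight α (F q.1) q.2 :=
    (hFm.comp measurable_fst).cosWeight α measurable_snd
  have hq : MeasurableSet {z : ℝ × ℝ | z.1 * z.2 < 0} :=
    measurableSet_lt (by fun_prop) measurable_const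
  have hs : MeasurableSet {q : S × ℝ | q.2 * F q.1 * (q.2 * G q.1) < 0} :=
    measurableSet_lt (by fun_prop) measurable_const
  have hpos : ∀ x, F x * G x < 0 → 0 < ∫⁻ r, ENNReal.ofReal (cosWeight α (F x) r) := by
    intro x hx
    have hF0 : F x ≠ 0 := fun h => by simp [h] at hx
    rw [← ofReal_integral_eq_lintegral_ofReal (integrable_cosWeight hα0 hα2 _)
      (ae_of_all _ (cosWeight_nonneg _ _)), ENNReal.ofReal_pos, integral_cosWeight hα0]
    exact mul_pos (integral_cosWeight_one_pos hα0 hα2) (Real.rpow_pos_of_pos (abs_pos.2 hF0) _)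
  have key : dampedLevy α μ F G {z | z.1 * z.2 < 0} =
      ∫⁻ x, {x | F x * G x < 0}.indicator
        (fun x => ∫⁻ r, ENNReal.ofReal (cosWeight α (F x) r)) x ∂μ := by
    rw [dampedLevy, Measure.map_apply (by fun_prop) hq, preimage_ofPred_eq, withDensity_apply _ hs,
      ← lintegral_indicator hs, lintegral_prod _ (by
        exact ((ENNReal.measurable_ofReal.comp hm).indicator hs).aemeasurable)]
    refine lintegral_congr fun x => ?_
    by_cases hx : F x * G x < 0
    · rw [indicator_of_mem (by exact hx)]
      refine lintegral_congr_ae ?_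
      -- Both coordinates carry the factor `r`, so their product has the sign of `F x * G x` unless
      -- `r = 0`.
      filter_upwards [Measure.ae_ne volume (0 : ℝ)] with r hr
      have hxr : r * F x * (r * G x) < 0 := by
        nlinarith [mul_pos (neg_pos.2 hx) (pow_pos (abs_pos.2 hr) 2), sq_abs r]
      exact indicator_of_mem (s := {q : S × ℝ | q.2 * F q.1 * (q.2 * G q.1) < 0}) hxr _
    · rw [indicator_of_notMem (by exact hx)]
      refine (lintegral_congr (g := fun _ : ℝ => 0) fun r => indicator_of_notMem ?_ _).trans
        lintegral_zero
      change ¬ (r * F x * (r * G x) < 0)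
      rw [not_lt] at hx ⊢
      nlinarith [mul_nonneg hx (sq_nonneg r)]
  have hmi : Measurable ({x | F x * G x < 0}.indicator
      fun x => ∫⁻ r, ENNReal.ofReal (cosWeight α (F x) r)) :=
    ((ENNReal.measurable_ofReal.comp hm).lintegral_prod_right').indicator
      (measurableSet_lt (hFm.mul hGm) measurable_const)
  rw [key, lintegral_eq_zero_iff hmi]
  refine Filter.eventually_congr (ae_of_all _ fun x => ?_)
  by_cases hx : F x * G x < 0
  · rw [indicator_of_mem (by exact hx)]
    exact iff_of_false (hpos x hx).ne' (not_le.2 hx)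
  · rw [indicator_of_notMem (by exact hx)]
    exact iff_of_true rfl (not_lt.1 hx)

end PairMeasure

/-- The sign of the product of two spectral functions is determined by the `L^α` norms of their
linear combinations. -/
theorem ae_mul_nonneg_of_integral_abs_rpow_eq {S S' : Type*} [MeasurableSpace S]
    [MeasurableSpace S'] {μ : Measure S} {μ' : Measure S'} [SFinite μ] [SFinite μ'] {α : ℝ}
    (hα0 : 0 < α) (hα2 : α < 2) {F G : S → ℝ} {f g : S' → ℝ}
    (hF : MemLp F (ENNReal.ofReal α) μ) (hG : MemLp G (ENNReal.ofReal α) μ)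
    (hf : MemLp f (ENNReal.ofReal α) μ') (hg : MemLp g (ENNReal.ofReal α) μ')
    (h : ∀ a b : ℝ, ∫ x, |a * F x + b * G x| ^ α ∂μ = ∫ x, |a * f x + b * g x| ^ α ∂μ')
    (hfg : ∀ᵐ x ∂μ', 0 ≤ f x * g x) : ∀ᵐ x ∂μ, 0 ≤ F x * G x := by
  -- Membership in `L^α` gives only a.e. measurability, so pass to measurable representatives.
  wlog hm : Measurable F ∧ Measurable G ∧ Measurable f ∧ Measurable g generalizing F G f g
  · have eF := hF.1.ae_eq_mk
    have eG := hG.1.ae_eq_mk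
    have ef := hf.1.ae_eq_mk
    have eg := hg.1.ae_eq_mk
    have := this ((memLp_congr_ae eF).1 hF) ((memLp_congr_ae eG).1 hG)
      ((memLp_congr_ae ef).1 hf) ((memLp_congr_ae eg).1 hg) (fun a b => ?_) ?_
      ⟨hF.1.stronglyMeasurable_mk.measurable, hG.1.stronglyMeasurable_mk.measurable,
        hf.1.stronglyMeasurable_mk.measurable, hg.1.stronglyMeasurable_mk.measurable⟩
    · filter_upwards [eF, eG, this] with x h1 h2 h3
      rwa [h1, h2]
    · refine ((integral_congr_ae ?_).trans (h a b)).trans (integral_congr_ae ?_)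
      · filter_upwards [eF, eG] with x h1 h2
        rw [h1, h2]
      · filter_upwards [ef, eg] with x h1 h2
        rw [h1, h2]
    · filter_upwards [ef, eg, hfg] with x h1 h2 h3
      rwa [← h1, ← h2]
  obtain ⟨hFm, hGm, hfm, hgm⟩ := hm
  have := isFiniteMeasure_dampedLevy (G := G) hα0 hα2 hFm hF
  have := isFiniteMeasure_dampedLevy (G := g) hα0 hα2 hfm hf
  have e : dampedLevy α μ F G = dampedLevy α μ' f g := by
    refine Measure.ext_of_charFunDual (funext fun L => ?_)
    rw [charFunDual_dampedLevy hα0 hα2 hFm hGm hF hG,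
      charFunDual_dampedLevy hα0 hα2 hfm hgm hf hg, h, h, h]
  rw [← dampedLevy_quadrants_eq_zero_iff hα0 hα2 hFm hGm, e,
    dampedLevy_quadrants_eq_zero_iff hα0 hα2 hfm hgm]
  exact hfg

/-! ### The sign condition as an obstruction to max-associability. -/

theorem HasStableRep.integral_pair_eq {T Ω S : Type*} [MeasurableSpace Ω] [MeasurableSpace S]
    {α : ℝ} {P : Measure Ω} {X : T → Ω → ℝ} {μ : Measure S} {f : T → S → ℝ}
    (h : HasStableRep α P X μ f) {s t : T} (hst : s ≠ t) (a b : ℝ) :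
    ∫ ω, Complex.exp (-(Complex.I * ((a * X s ω + b * X t ω : ℝ) : ℂ))) ∂P =
      ((Real.exp (-∫ x, |a * f s x + b * f t x| ^ α ∂μ) : ℝ) : ℂ) := by
  classical
  have := h.charFun_eq {s, t} fun r => if r = s then a else b
  simpa [Finset.sum_pair hst, hst.symm] using this

theorem MaxAssociable.ae_mul_nonneg {T Ω S : Type*} [MeasurableSpace Ω] [MeasurableSpace S]
    {α : ℝ} (hα0 : 0 < α) (hα2 : α < 2) {P : Measure Ω} {X : T → Ω → ℝ} {μ : Measure S}
    [SFinite μ] {g : T → S → ℝ} (h : MaxAssociable.{v} α P X) (hg : HasStableRep α P X μ g)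
    (s t : T) : ∀ᵐ x ∂μ, 0 ≤ g s x * g t x := by
  -- Coefficients are indexed by `T`, so two free ones need distinct times.
  rcases eq_or_ne s t with rfl | hst
  · exact ae_of_all _ fun x => mul_self_nonneg _
  obtain ⟨Ω', _, P', _, Y, S', _, μ', _, f, hX, hY⟩ := h
  refine ae_mul_nonneg_of_integral_abs_rpow_eq hα0 hα2 (hg.memLp s) (hg.memLp t)
    (hX.memLp s) (hX.memLp t) (fun a b => ?_) ?_
  · have := (hg.integral_pair_eq hst a b).symm.trans (hX.integral_pair_eq hst a b)
    rw [Complex.ofReal_inj, Real.exp_eq_exp, neg_inj] at this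
    exact this
  · filter_upwards [hY.nonneg s, hY.nonneg t] with x h1 h2
    exact mul_nonneg h1 h2

theorem not_maxAssociable_of_continuousAt {T Ω S : Type*} [MeasurableSpace Ω]
    [MeasurableSpace S] [TopologicalSpace S]
    {α : ℝ} (hα0 : 0 < α) (hα2 : α < 2) {P : Measure Ω} {X : T → Ω → ℝ} {μ : Measure S}
    [SFinite μ] [μ.IsOpenPosMeasure] {g : T → S → ℝ} (hg : HasStableRep α P X μ g)
    {s t : T} {p : S} (hs : ContinuousAt (g s) p) (ht : ContinuousAt (g t) p)
    (hneg : g s p * g t p < 0) : ¬ MaxAssociable.{v} α P X := by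
  intro h
  have h1 := h.ae_mul_nonneg hα0 hα2 hg s t
  have h2 : ∀ᶠ x in nhds p, g s x * g t x < 0 := (hs.mul ht).eventually_lt_const hneg
  have h3 : μ {x | ¬ 0 ≤ g s x * g t x} = 0 := h1
  refine (Measure.measure_pos_of_mem_nhds μ h2).ne' (measure_mono_null (fun x hx => ?_) h3)
  exact not_le.2 hx

/-! ### Two values against three. -/

/-- Among three distinct values, one lies strictly between the other two. -/
theorem exists_mul_sub_neg_of_ne {ι : Type*} {K : ι → ℝ} {i j k : ι} (hij : K i ≠ K j)
    (hjk : K j ≠ K k) (hik : K i ≠ K k) :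
    ∃ a ∈ ({i, j, k} : Set ι), ∃ b ∈ ({i, j, k} : Set ι), ∃ c ∈ ({i, j, k} : Set ι),
      (K a - K b) * (K c - K b) < 0 := by
  rcases hij.lt_or_gt with h1 | h1 <;> rcases hjk.lt_or_gt with h2 | h2 <;>
    rcases hik.lt_or_gt with h3 | h3
  · exact ⟨i, by simp, j, by simp, k, by simp, by nlinarith⟩
  · linarith
  · exact ⟨i, by simp, k, by simp, j, by simp, by nlinarith⟩
  · exact ⟨k, by simp, i, by simp, j, by simp, by nlinarith⟩
  · exact ⟨j, by simp, i, by simp, k, by simp, by nlinarith⟩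
  · exact ⟨i, by simp, k, by simp, j, by simp, by nlinarith⟩
  · linarith
  · exact ⟨i, by simp, j, by simp, k, by simp, by nlinarith⟩

/-- A function without three distinct values on a set is there an affine image of an indicator. -/
theorem exists_eq_mul_indicator_add {U : Type*} (K : U → ℝ) (s : Set U)
    (h : ∀ i ∈ s, ∀ j ∈ s, ∀ k ∈ s, K i ≠ K j → K j ≠ K k → K i = K k) :
    ∃ (f c : ℝ) (A : Set U), ∀ u ∈ s, K u = f * A.indicator (fun _ => (1 : ℝ)) u + c := by
  classical
  by_cases h2 : ∃ i ∈ s, ∃ j ∈ s, K i ≠ K j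
  · obtain ⟨i, hi, j, hj, hij⟩ := h2
    refine ⟨K j - K i, K i, {u | K u ≠ K i}, fun u hu => ?_⟩
    by_cases hui : K u = K i
    · simp [hui]
    · have : K u = K j := by
        by_contra huj
        exact hij ((h j hj u hu i hi (Ne.symm huj) hui).symm)
      simp [this, hij.symm]
  · push Not at h2
    rcases s.eq_empty_or_nonempty with rfl | ⟨i, hi⟩
    · exact ⟨0, 0, ∅, by simp⟩
    · exact ⟨0, K i, ∅, fun u hu => by simp [h2 u hu i hi]⟩

/-! ### Linear fractional stable motions and Telecom processes. -/

theorem lfsm_not_maxAssociable {Ω : Type*} [MeasurableSpace Ω] {P : Measure Ω} {X : ℝ → Ω → ℝ}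
    {α : ℝ} (hα0 : 0 < α) (hα2 : α < 2) {H a b : ℝ} (hH : H ≠ 1 / α) (hab : 0 < |a| + |b|)
    (hX : HasStableRep α P X (volume : Measure ℝ) (lfsmKernel α H a b)) :
    ¬ MaxAssociable.{v} α P X := by
  set β := H - 1 / α with hβ
  have hβ0 : β ≠ 0 := sub_ne_zero.2 hH
  let K : ℝ → ℝ := fun u => a * (max u 0) ^ β + b * (max (-u) 0) ^ β
  have hK : ∀ t u, lfsmKernel α H a b t u = K (t + u) - K u := fun t u => by
    simp only [lfsmKernel, K, ← hβ]; ring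
  have hpow : ∀ x y : ℝ, 0 < x → 0 < y → x ≠ y → x ^ β ≠ y ^ β := fun x y hx hy hxy h =>
    hxy ((Real.rpow_left_inj hx.le hy.le hβ0).1 h)
  have hpos : ∀ u, 0 < u → K u = a * u ^ β := fun u hu => by
    simp [K, max_eq_left hu.le, max_eq_right (neg_nonpos.2 hu.le), Real.zero_rpow hβ0]
  have hnegv : ∀ u, 0 < u → K (-u) = b * u ^ β := fun u hu => by
    simp [K, max_eq_left hu.le, max_eq_right (neg_nonpos.2 hu.le), Real.zero_rpow hβ0]
  have hcont : ∀ u ≠ 0, ContinuousAt K u := by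
    intro u hu
    rcases hu.lt_or_gt with hu | hu
    · have : K =ᶠ[nhds u] fun v => b * (-v) ^ β := by
        filter_upwards [gt_mem_nhds hu] with v hv
        rw [← hnegv (-v) (neg_pos.2 hv), neg_neg]
      refine ContinuousAt.congr ?_ this.symm
      exact continuousAt_const.mul (continuousAt_neg.rpow_const (Or.inl (by simpa using hu.ne)))
    · have : K =ᶠ[nhds u] fun v => a * v ^ β := by
        filter_upwards [lt_mem_nhds hu] with v hv
        exact hpos v hv
      refine ContinuousAt.congr ?_ this.symm
      exact continuousAt_const.mul (continuousAt_id.rpow_const (Or.inl hu.ne'))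
  -- A nonzero power is injective on a half-line, so three points on the side with nonzero
  -- coefficient suffice; they avoid the possible singularity at `0`.
  obtain ⟨u, v, w, hu, hv, hw, h1, h2, h3⟩ : ∃ u v w : ℝ, u ≠ 0 ∧ v ≠ 0 ∧ w ≠ 0 ∧
      K u ≠ K v ∧ K v ≠ K w ∧ K u ≠ K w := by
    by_cases ha : a = 0
    · have hb : b ≠ 0 := by rintro rfl; simp [ha] at hab
      refine ⟨-1, -2, -3, by norm_num, by norm_num, by norm_num, ?_, ?_, ?_⟩ <;>
      · rw [hnegv _ (by norm_num), hnegv _ (by norm_num)]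
        exact fun h => hpow _ _ (by norm_num) (by norm_num) (by norm_num) (mul_left_cancel₀ hb h)
    · refine ⟨1, 2, 3, by norm_num, by norm_num, by norm_num, ?_, ?_, ?_⟩ <;>
      · rw [hpos _ (by norm_num), hpos _ (by norm_num)]
        exact fun h => hpow _ _ (by norm_num) (by norm_num) (by norm_num) (mul_left_cancel₀ ha h)
  have hne : ∀ x ∈ ({u, v, w} : Set ℝ), x ≠ 0 := by
    rintro x (rfl | rfl | rfl) <;> assumption
  -- `y` carries the middle value; the times `x - y` and `z - y` move it to the other two points.
  obtain ⟨x, hx, y, hy, z, hz, hxyz⟩ := exists_mul_sub_neg_of_ne h1 h2 h3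
  have hc : ∀ x ∈ ({u, v, w} : Set ℝ), ContinuousAt (lfsmKernel α H a b (x - y)) y := by
    intro x hx
    rw [show lfsmKernel α H a b (x - y) = fun q => K (x - y + q) - K q from funext (hK _)]
    refine ContinuousAt.sub (ContinuousAt.comp' (f := fun q => x - y + q) ?_ (by fun_prop))
      (hcont y (hne y hy))
    simpa using hcont x (hne x hx)
  refine not_maxAssociable_of_continuousAt hα0 hα2 hX (hc x hx) (hc z hz) ?_
  simpa [hK] using hxyz

theorem telecom_not_maxAssociable {Ω : Type*} [MeasurableSpace Ω] {P : Measure Ω}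
    {X : ℝ → Ω → ℝ} {α : ℝ} (hα0 : 0 < α) (hα2 : α < 2) {H : ℝ}
    (hX : HasStableRep α P X (volume : Measure (ℝ × ℝ)) (telecomKernel α H)) :
    ¬ MaxAssociable.{v} α P X := by
  have hF : Continuous telecomF := by unfold telecomF; fun_prop
  have hc : ∀ t, Continuous (telecomKernel α H t) := fun t => by
    unfold telecomKernel; fun_prop
  -- At scale `e^0 = 1`, `telecomF` equals `0`, `1/2`, `1` at `-1`, `-1/2`, `0`, so the two
  -- increments are `1/2` and `-1/2`.
  refine not_maxAssociable_of_continuousAt hα0 hα2 hX (s := 1 / 2) (t := -1 / 2)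
    (p := (0, -1 / 2)) (hc _).continuousAt (hc _).continuousAt ?_
  norm_num [telecomKernel, telecomF]

/-! ### Mixed moving averages. -/

section MixedMovingAverage

variable {E : Type*} [MeasurableSpace E] {ν : Measure E} [SigmaFinite ν]

theorem exists_indicator_of_maxAssociable {Ω : Type*} [MeasurableSpace Ω] {P : Measure Ω}
    {X : ℝ → Ω → ℝ} {α : ℝ} (hα0 : 0 < α) (hα2 : α < 2) [TopologicalSpace E]
    [ν.IsOpenPosMeasure] {G : E → ℝ → ℝ} {N : Set (E × ℝ)}
    (hX : HasStableRep α P X (ν.prod volume) (incrementKernel G))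
    (hG : ∀ p ∉ N, ContinuousAt (fun q : E × ℝ => G q.1 q.2) p) (h : MaxAssociable.{v} α P X) :
    ∃ (f c : E → ℝ) (A : E → Set ℝ), ∀ (x : E) (u : ℝ), (x, u) ∉ N →
      G x u = f x * (A x).indicator (fun _ => (1 : ℝ)) u + c x := by
  -- No measurability in `x` is asked of `f`, `c`, `A`, so each `x` is treated alone.
  suffices ∀ x, ∃ (f c : ℝ) (A : Set ℝ), ∀ u ∈ {u | (x, u) ∉ N},
      G x u = f * A.indicator (fun _ => (1 : ℝ)) u + c by
    choose f c A hfcA using this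
    exact ⟨f, c, A, hfcA⟩
  refine fun x => exists_eq_mul_indicator_add (G x) _ fun u hu v hv w hw huv hvw => ?_
  by_contra huw
  obtain ⟨a, ha, b, hb, c, hc, habc⟩ := exists_mul_sub_neg_of_ne huv hvw huw
  have hN : ∀ a ∈ ({u, v, w} : Set ℝ), (x, a) ∉ N := by
    rintro a (rfl | rfl | rfl) <;> assumption
  have hcont : ∀ a ∈ ({u, v, w} : Set ℝ), ContinuousAt (incrementKernel G (a - b)) (x, b) := by
    intro a ha
    refine ContinuousAt.sub (ContinuousAt.comp' (g := fun q : E × ℝ => G q.1 q.2)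
      (f := fun q : E × ℝ => (q.1, a - b + q.2)) ?_ (by fun_prop)) (hG _ (hN b hb))
    simpa using hG _ (hN a ha)
  refine not_maxAssociable_of_continuousAt hα0 hα2 hX (hcont a ha) (hcont c hc) ?_ h
  simpa [incrementKernel] using habc

/-- From a point outside `A x` every increment is `0` or `f x`, from a point inside it is `0` or `-f
x`; products are `0` or `f x ^ 2`. Translation invariance keeps the shifted points off `N` a.e. -/
theorem incrementKernel_mul_nonneg {G : E → ℝ → ℝ} {N : Set (E × ℝ)}
    (hN : (ν.prod volume) N = 0) {f c : E → ℝ} {A : E → Set ℝ}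
    (h : ∀ (x : E) (u : ℝ), (x, u) ∉ N →
      G x u = f x * (A x).indicator (fun _ => (1 : ℝ)) u + c x) (s t : ℝ) :
    ∀ᵐ p ∂ν.prod volume, 0 ≤ incrementKernel G s p * incrementKernel G t p := by
  have hshift : ∀ t : ℝ, ∀ᵐ p ∂ν.prod volume, (p.1, t + p.2) ∉ N := fun t => by
    have := ((MeasurePreserving.id ν).prod (measurePreserving_add_left volume t)).quasiMeasurePreserving
    exact this.ae (p := fun p => p ∉ N) (measure_eq_zero_iff_ae_notMem.1 hN)
  filter_upwards [hshift s, hshift t, measure_eq_zero_iff_ae_notMem.1 hN] with p h1 h2 h3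
  rw [incrementKernel, incrementKernel, h _ _ h1, h _ _ h2, h _ _ h3]
  by_cases i1 : s + p.2 ∈ A p.1 <;> by_cases i2 : t + p.2 ∈ A p.1 <;>
    by_cases i3 : p.2 ∈ A p.1 <;> simp [i1, i2, i3, mul_self_nonneg]

end MixedMovingAverage

/-! ### Void probabilities of Poisson processes. -/

theorem measurableSet_sample_avoid {Z : Type*} [MeasurableSpace Z] {B : Set Z}
    (hB : MeasurableSet B) : MeasurableSet {w : ℕ × (ℕ → Z) | ∀ k < w.1, w.2 k ∉ B} := by
  have e : {w : ℕ × (ℕ → Z) | ∀ k < w.1, w.2 k ∉ B} =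
      ⋂ k : ℕ, {w | w.1 ≤ k} ∪ (fun w : ℕ × (ℕ → Z) => w.2 k) ⁻¹' Bᶜ := by
    ext w
    simp only [mem_iInter, mem_union, mem_preimage, mem_compl_iff]
    exact forall_congr' fun k => imp_iff_not_or.trans (or_congr_left not_lt)
  rw [e]
  refine MeasurableSet.iInter fun k => MeasurableSet.union ?_ ?_
  · exact measurable_fst (measurableSet_Iic (a := k))
  · exact ((measurable_pi_apply k).comp measurable_snd) hB.compl

/-- A Poisson number of independent points with intensity the finite measure `κ` avoids `B` with
probability `exp (-κ B)`. -/
theorem exists_poisson_sample_avoid {Z : Type u} [MeasurableSpace Z] [Nonempty Z] (κ : Measure Z)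
    [IsFiniteMeasure κ] :
    ∃ Q : Measure (ℕ × (ℕ → Z)), IsProbabilityMeasure Q ∧ ∀ B, MeasurableSet B →
      Q {w | ∀ k < w.1, w.2 k ∉ B} = ENNReal.ofReal (Real.exp (-κ.real B)) := by
  obtain ⟨π, _, hπ⟩ : ∃ π : Measure Z, IsProbabilityMeasure π ∧ κ = κ univ • π := by
    by_cases h : κ = 0
    · exact ⟨Measure.dirac (Classical.arbitrary Z), inferInstance, by simp [h]⟩
    · have hu : κ univ ≠ 0 := by simpa using h
      have : NeZero κ := ⟨h⟩
      exact ⟨(κ univ)⁻¹ • κ, inferInstance, by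
        rw [smul_smul, ENNReal.mul_inv_cancel hu (measure_ne_top _ _), one_smul]⟩
  refine ⟨(ProbabilityTheory.poissonMeasure (κ univ).toNNReal).prod
    (Measure.infinitePi fun _ : ℕ => π), inferInstance, fun B hB => ?_⟩
  have hfib : ∀ n : ℕ, (Measure.infinitePi fun _ : ℕ => π) {v | ∀ k < n, v k ∉ B} =
      ENNReal.ofReal (π.real Bᶜ ^ n) := by
    intro n
    have e : {v : ℕ → Z | ∀ k < n, v k ∉ B} = (Finset.range n : Set ℕ).pi fun _ => Bᶜ := by
      ext v; simp [Set.mem_pi]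
    rw [e, Measure.infinitePi_pi _ fun _ _ => hB.compl, Finset.prod_const, Finset.card_range,
      ENNReal.ofReal_pow measureReal_nonneg, ofReal_measureReal]
  have hm := measurableSet_sample_avoid hB
  have hκ : κ.real B = κ.real univ * (1 - π.real Bᶜ) := by
    rw [probReal_compl_eq_one_sub hB, sub_sub_cancel]
    conv_lhs => rw [hπ]
    simp [measureReal_def]
  set r := κ.real univ with hr
  set q := π.real Bᶜ with hq
  have hr' : ((κ univ).toNNReal : ℝ) = r := rfl
  -- `n` independent points all avoid `B` with probability `q ^ n`; averaging over the Poisson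
  -- number gives `exp (-r (1 - q))`.
  have hsum : HasSum (fun n : ℕ => q ^ n * (Real.exp (-r) * r ^ n / n.factorial))
      (Real.exp (-κ.real B)) := by
    have := (NormedSpace.expSeries_div_hasSum_exp (𝔸 := ℝ) (r * q)).mul_left (Real.exp (-r))
    rw [← Real.exp_eq_exp_ℝ, ← Real.exp_add] at this
    rw [show -κ.real B = -r + r * q by rw [hκ]; ring]
    rwa [show (fun n : ℕ => q ^ n * (Real.exp (-r) * r ^ n / n.factorial)) =
      fun n : ℕ => Real.exp (-r) * ((r * q) ^ n / n.factorial) by ext n; rw [mul_pow]; ring]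
  rw [Measure.prod_apply hm, lintegral_countable', ← hsum.tsum_eq,
    ENNReal.ofReal_tsum_of_nonneg (fun n => by positivity) hsum.summable]
  refine tsum_congr fun n => ?_
  rw [ProbabilityTheory.poissonMeasure_singleton, hr']
  rw [ENNReal.ofReal_mul (by positivity), ← hfib n]
  rfl

/-- Void probabilities of a Poisson point process with intensity `ρ`. The points are
`V n k`, `k < N n`. -/
theorem exists_poisson_process_avoid {Z : Type u} [MeasurableSpace Z] [Nonempty Z] (ρ : Measure Z)
    [SFinite ρ] :
    ∃ (Ω' : Type u) (_ : MeasurableSpace Ω') (P' : Measure Ω') (_ : IsProbabilityMeasure P')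
      (N : ℕ → Ω' → ℕ) (V : ℕ → ℕ → Ω' → Z), (∀ n, Measurable (N n)) ∧
      (∀ n k, Measurable (V n k)) ∧ ∀ B, MeasurableSet B → ρ B ≠ ⊤ →
        P' {ω | ∀ n, ∀ k < N n ω, V n k ω ∉ B} = ENNReal.ofReal (Real.exp (-ρ.real B)) := by
  -- The intensity is cut into finite pieces sampled independently, so the void probabilities
  -- multiply and the exponents add.
  choose Q hQ hQB using fun n => exists_poisson_sample_avoid (sfiniteSeq ρ n)
  refine ⟨ℕ → ℕ × (ℕ → Z), inferInstance, Measure.infinitePi Q, inferInstance,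
    fun n ω => (ω n).1, fun n k ω => (ω n).2 k, fun n => by fun_prop, fun n k => by fun_prop,
    fun B hB hρB => ?_⟩
  have e : {ω : ℕ → ℕ × (ℕ → Z) | ∀ n, ∀ k < (ω n).1, (ω n).2 k ∉ B} =
      univ.pi fun _ => {w | ∀ k < w.1, w.2 k ∉ B} := by
    ext ω; simp [Set.mem_pi]
  rw [e, Measure.infinitePi_pi_univ _ fun _ => measurableSet_sample_avoid hB]
  have h1 := (ENNReal.multipliable_of_le_one
    (f := fun n => Q n {w | ∀ k < w.1, w.2 k ∉ B}) fun n => prob_le_one).hasProd.tendsto_prod_nat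
  refine tendsto_nhds_unique h1 ?_
  have hρ : ∑' n, sfiniteSeq ρ n B = ρ B := by
    rw [← Measure.sum_apply _ hB, sum_sfiniteSeq]
  have h2 := (ENNReal.hasSum_toReal (hρ.symm ▸ hρB)).tendsto_sum_nat
  rw [← ENNReal.tsum_toReal_eq fun n => measure_ne_top _ _, hρ] at h2
  have h3 := ENNReal.tendsto_ofReal ((Real.continuous_exp.tendsto _).comp h2.neg)
  refine h3.congr fun n => ?_
  simp_rw [hQB _ B hB]
  rw [← ENNReal.ofReal_prod_of_nonneg fun i _ => (Real.exp_pos _).le, ← Real.exp_sum,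
    Finset.sum_neg_distrib]
  rfl

/-! ### Fréchet processes from Poisson points. -/

section Frechet

variable {T : Type*} {S : Type u} [MeasurableSpace S] {μ : Measure S} {α : ℝ} {f : T → S → ℝ}

theorem measurable_sup'_div (hfm : ∀ t, Measurable (f t)) (s : Finset T) (hs : s.Nonempty)
    (a : T → ℝ) : Measurable fun x => s.sup' hs fun t => f t x / a t := by
  convert Finset.measurable_sup' hs (f := fun t x => f t x / a t)
    (fun t _ => (hfm t).div_const _) using 1
  ext x; simp

theorem integrable_sup'_rpow (hα0 : 0 < α) (hfm : ∀ t, Measurable (f t)) (hf0 : ∀ t x, 0 ≤ f t x)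
    (hf : ∀ t, MemLp (f t) (ENNReal.ofReal α) μ) (s : Finset T) (hs : s.Nonempty) (a : T → ℝ)
    (ha : ∀ t ∈ s, 0 < a t) :
    Integrable (fun x => (s.sup' hs fun t => f t x / a t) ^ α) μ := by
  have hi : Integrable (fun x => ∑ t ∈ s, |f t x / a t| ^ α) μ := by
    refine integrable_finsetSum _ fun t _ => ?_
    simp_rw [div_eq_mul_inv]
    exact integrable_abs_rpow_of_memLp hα0 ((hf t).mul_const _)
  have hm : Measurable fun x => (s.sup' hs fun t => f t x / a t) ^ α :=
    (measurable_sup'_div hfm s hs a).pow_const _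
  refine hi.mono' hm.aestronglyMeasurable (ae_of_all _ fun x => ?_)
  obtain ⟨t, ht, hst⟩ := s.exists_mem_eq_sup' hs fun t => f t x / a t
  have h0 : 0 ≤ f t x / a t := div_nonneg (hf0 t x) (ha t ht).le
  rw [hst, Real.norm_of_nonneg (Real.rpow_nonneg h0 _)]
  refine le_trans ?_ (Finset.single_le_sum (f := fun t => |f t x / a t| ^ α)
    (fun t _ => Real.rpow_nonneg (abs_nonneg _) _) ht)
  rw [abs_of_nonneg h0]

/-- Every family of nonnegative functions in `L^α` represents an `α`-Fréchet process. -/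
theorem exists_hasExtremalRep [SFinite μ] (hα0 : 0 < α) (hfm : ∀ t, Measurable (f t))
    (hf0 : ∀ t x, 0 ≤ f t x) (hf : ∀ t, MemLp (f t) (ENNReal.ofReal α) μ) :
    ∃ (Ω' : Type u) (_ : MeasurableSpace Ω') (P' : Measure Ω') (_ : IsProbabilityMeasure P')
      (Y : T → Ω' → ℝ), HasExtremalRep α P' Y μ f := by
  rcases isEmpty_or_nonempty S with hS | hS
  · refine ⟨PUnit, inferInstance, Measure.dirac PUnit.unit, inferInstance, fun _ _ => 0, hf,
      fun t => ae_of_all _ (hf0 t), fun t => measurable_const, fun t => ae_of_all _ fun _ => le_rfl,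
      fun s hs a ha => ?_⟩
    have e : {ω : PUnit.{u + 1} | ∀ t ∈ s, (0 : ℝ) ≤ a t} = univ :=
      eq_univ_of_forall fun _ t ht => (ha t ht).le
    rw [e, probReal_univ, Measure.eq_zero_of_isEmpty μ]
    simp
  obtain ⟨Ω', _, P', _, N, V, hN, hV, hNV⟩ :=
    exists_poisson_process_avoid (μ.prod ((volume : Measure ℝ).restrict (Ioi 0)))
  -- A point `(x, r)` contributes `f t x * r ^ (-1/α)`, which exceeds `a` for `r` in an interval of
  -- length `(f t x / a) ^ α`. Extended values let the supremum exist before its finiteness is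
  -- known.
  let D : T → S × ℝ → ENNReal := fun t z => ENNReal.ofReal (f t z.1 / z.2 ^ α⁻¹)
  have hD : ∀ t, Measurable (D t) := fun t => by fun_prop
  let M : T → Ω' → ENNReal := fun t ω => ⨆ n, ⨆ k, if k < N n ω then D t (V n k ω) else 0
  have hM : ∀ t, Measurable (M t) := fun t =>
    Measurable.iSup fun n => Measurable.iSup fun k =>
      Measurable.ite (measurableSet_lt measurable_const (hN n)) ((hD t).comp (hV n k))
        measurable_const
  have hcdf : ∀ (s : Finset T) (hs : s.Nonempty) (a : T → ℝ), (∀ t ∈ s, 0 < a t) →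
      P' {ω | ∀ t ∈ s, M t ω ≤ ENNReal.ofReal (a t)} =
        ENNReal.ofReal (Real.exp (-∫ x, (s.sup' hs fun t => f t x / a t) ^ α ∂μ)) := by
    intro s hs a ha
    have hi := integrable_sup'_rpow hα0 hfm hf0 hf s hs a ha
    have h0 : ∀ x, 0 ≤ s.sup' hs fun t => f t x / a t := fun x => by
      obtain ⟨t, ht⟩ := hs
      exact (div_nonneg (hf0 t x) (ha t ht).le).trans
        (Finset.le_sup' (fun t => f t x / a t) ht)
    let B : Set (S × ℝ) := {z | ∃ t ∈ s, ENNReal.ofReal (a t) < D t z}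
    have hB : MeasurableSet B := by
      have : B = ⋃ t ∈ s, {z | ENNReal.ofReal (a t) < D t z} := by ext; simp [B]
      rw [this]
      exact s.measurableSet_biUnion fun t _ => measurableSet_lt measurable_const (hD t)
    have hρ : μ.prod ((volume : Measure ℝ).restrict (Ioi 0)) B =
        ENNReal.ofReal (∫ x, (s.sup' hs fun t => f t x / a t) ^ α ∂μ) := by
      rw [Measure.prod_apply hB, ofReal_integral_eq_lintegral_ofReal hi
        (ae_of_all _ fun x => Real.rpow_nonneg (h0 x) _)]
      refine lintegral_congr fun x => ?_
      rw [Measure.restrict_apply (measurable_prodMk_left hB)]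
      have : Prod.mk x ⁻¹' B ∩ Ioi 0 = Ioo 0 ((s.sup' hs fun t => f t x / a t) ^ α) := by
        ext r
        rw [mem_inter_iff, and_comm, mem_Ioo, mem_Ioi]
        refine and_congr_right fun hr => ?_
        have hr' : 0 < r ^ α⁻¹ := Real.rpow_pos_of_pos hr _
        rw [← Real.rpow_inv_lt_iff_of_pos hr.le (h0 x) hα0, Finset.lt_sup'_iff]
        refine exists_congr fun t => and_congr_right fun ht => ?_
        rw [ENNReal.ofReal_lt_ofReal_iff_of_nonneg (ha t ht).le, lt_div_iff₀ hr',
          lt_div_iff₀ (ha t ht), mul_comm]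
      rw [this, Real.volume_Ioo, sub_zero]
    have e : {ω | ∀ t ∈ s, M t ω ≤ ENNReal.ofReal (a t)} =
        {ω | ∀ n, ∀ k < N n ω, V n k ω ∉ B} := by
      ext ω
      simp only [M, B, iSup_le_iff, mem_ofPred_eq, not_exists, not_and, not_lt]
      constructor
      · intro h n k hk t ht
        simpa [hk] using h t ht n k
      · intro h t ht n k
        split_ifs with hk
        · exact h n k hk t ht
        · exact zero_le
    rw [e, hNV B hB (by rw [hρ]; exact ENNReal.ofReal_ne_top), measureReal_def, hρ,
      ENNReal.toReal_ofReal (integral_nonneg fun x => Real.rpow_nonneg (h0 x) _)]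
  -- The distribution function at level `n + 1` tends to `1`, so the supremum is a.s. finite.
  have hfin : ∀ t, ∀ᵐ ω ∂P', M t ω ≠ ⊤ := by
    intro t
    have h1 : ∀ n : ℕ, ENNReal.ofReal (Real.exp (-(((n : ℝ) + 1) ^ (-α) * ∫ x, f t x ^ α ∂μ))) ≤
        P' {ω | M t ω ≠ ⊤} := by
      intro n
      have hn : (0 : ℝ) < (n : ℝ) + 1 := by positivity
      have := hcdf {t} (Finset.singleton_nonempty t) (fun _ => (n : ℝ) + 1) fun _ _ => hn
      simp only [Finset.sup'_singleton, Finset.mem_singleton, forall_eq] at this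
      rw [← integral_const_mul]
      have e : ∀ x, ((n : ℝ) + 1) ^ (-α) * f t x ^ α = (f t x / ((n : ℝ) + 1)) ^ α := fun x => by
        rw [Real.div_rpow (hf0 t x) hn.le, Real.rpow_neg hn.le, div_eq_mul_inv, mul_comm]
      simp_rw [e]
      rw [← this]
      exact measure_mono fun ω hω => ne_top_of_le_ne_top ENNReal.ofReal_ne_top hω
    have h2 : Filter.Tendsto (fun n : ℕ =>
        ENNReal.ofReal (Real.exp (-(((n : ℝ) + 1) ^ (-α) * ∫ x, f t x ^ α ∂μ))))
        Filter.atTop (nhds 1) := by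
      have h3 := ((tendsto_rpow_neg_atTop hα0).comp
        (Filter.tendsto_atTop_add_const_right _ 1 tendsto_natCast_atTop_atTop)).mul_const
          (∫ x, f t x ^ α ∂μ)
      have h4 := ENNReal.tendsto_ofReal ((Real.continuous_exp.tendsto _).comp h3.neg)
      simpa [Function.comp_def] using h4
    have h3 := le_antisymm prob_le_one (le_of_tendsto' h2 h1)
    exact (prob_compl_eq_zero_iff ((hM t) (measurableSet_singleton _).compl)).2 h3
  refine ⟨Ω', _, P', inferInstance, fun t ω => (M t ω).toReal, hf, fun t => ae_of_all _ (hf0 t),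
    fun t => (hM t).ennreal_toReal, fun t => ae_of_all _ fun _ => ENNReal.toReal_nonneg,
    fun s hs a ha => ?_⟩
  have e : {ω | ∀ t ∈ s, (M t ω).toReal ≤ a t} =ᵐ[P']
      {ω | ∀ t ∈ s, M t ω ≤ ENNReal.ofReal (a t)} := by
    filter_upwards [(ae_ball_iff s.countable_toSet).2 fun t _ => hfin t] with ω hω
    refine propext (forall₂_congr fun t ht => ?_)
    rw [ENNReal.le_ofReal_iff_toReal_le (hω t ht) (ha t ht).le]
  rw [measureReal_congr e, measureReal_def, hcdf s hs a ha,
    ENNReal.toReal_ofReal (Real.exp_pos _).le]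

end Frechet

/-! ### Sufficiency of the sign condition, and the proposition. -/

/-- One negative `y i` forces all the others to be nonpositive, so taking absolute values changes
the sum by at most a global sign. -/
theorem abs_sum_mul_abs_eq {T : Type*} {s : Finset T} {a y : T → ℝ}
    (h : ∀ i ∈ s, ∀ j ∈ s, 0 ≤ y i * y j) : |∑ t ∈ s, a t * (|y t|)| = |∑ t ∈ s, a t * y t| := by
  by_cases hn : ∃ i ∈ s, y i < 0
  · obtain ⟨i, hi, hyi⟩ := hn
    have : ∀ t ∈ s, a t * |y t| = -(a t * y t) := fun t ht => by
      rw [abs_of_nonpos (nonpos_of_mul_nonneg_right (h i hi t ht) hyi), mul_neg]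
    rw [Finset.sum_congr rfl this, Finset.sum_neg_distrib, abs_neg]
  · push Not at hn
    rw [Finset.sum_congr rfl fun t ht => by rw [abs_of_nonneg (hn t ht)]]

theorem maxAssociable_of_ae_mul_nonneg {T Ω : Type*} {S : Type u} [MeasurableSpace Ω]
    [MeasurableSpace S] {α : ℝ} (hα0 : 0 < α) {P : Measure Ω} {X : T → Ω → ℝ} {μ : Measure S}
    [SigmaFinite μ] {g : T → S → ℝ} (hgm : ∀ t, Measurable (g t)) (hg : HasStableRep α P X μ g)
    (h : ∀ s t, ∀ᵐ x ∂μ, 0 ≤ g s x * g t x) : MaxAssociable.{u} α P X := by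
  have hL : ∀ t, MemLp (fun x => |g t x|) (ENNReal.ofReal α) μ := fun t => (hg.memLp t).abs
  obtain ⟨Ω', _, P', _, Y, hY⟩ := exists_hasExtremalRep hα0 (f := fun t x => |g t x|)
    (fun t => (hgm t).abs) (fun t x => abs_nonneg _) hL
  refine ⟨Ω', _, P', inferInstance, Y, S, _, μ, inferInstance, fun t x => |g t x|,
    ⟨hL, hg.measurable, fun s a => ?_⟩, hY⟩
  rw [hg.charFun_eq s a]
  congr 3
  refine integral_congr_ae ?_
  -- The exceptional set depends on the pair of times, but each finite-dimensional law involves only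
  -- finitely many pairs.
  have : ∀ᵐ x ∂μ, ∀ i ∈ s, ∀ j ∈ s, 0 ≤ g i x * g j x :=
    (ae_ball_iff s.countable_toSet).2 fun i _ => (ae_ball_iff s.countable_toSet).2 fun j _ => h i j
  filter_upwards [this] with x hx
  rw [abs_sum_mul_abs_eq hx]

theorem proposition4p3 {Ω : Type w} [MeasurableSpace Ω] (P : Measure Ω)
    [IsProbabilityMeasure P] (X : ℝ → Ω → ℝ) (α : ℝ) (hα0 : 0 < α) (hα2 : α < 2) :
    (∀ (E : Type u) [MetricSpace E] [MeasurableSpace E] [BorelSpace E] [StandardBorelSpace E]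
        (ν : Measure E) [SigmaFinite ν] [ν.IsOpenPosMeasure] (G : E → ℝ → ℝ) (N : Set (E × ℝ)),
        Measurable (fun p : E × ℝ => G p.1 p.2) →
        HasStableRep α P X (ν.prod volume) (incrementKernel G) →
        IsClosed N →
        (ν.prod volume) N = 0 →
        (∀ p ∉ N, ContinuousAt (fun q : E × ℝ => G q.1 q.2) p) →
        (MaxAssociable.{u} α P X ↔
          ∃ (f c : E → ℝ) (A : E → Set ℝ), ∀ (x : E) (u : ℝ), (x, u) ∉ N →
            G x u = f x * (A x).indicator (fun _ => (1 : ℝ)) u + c x)) ∧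
    (∀ H a b : ℝ, 0 < H → H < 1 → H ≠ 1 / α → 0 < |a| + |b| →
        HasStableRep α P X (volume : Measure ℝ) (lfsmKernel α H a b) →
        ¬ MaxAssociable.{u} α P X) ∧
    (∀ H : ℝ, 1 < α → 1 / α < H → H < 1 →
        HasStableRep α P X (volume : Measure (ℝ × ℝ)) (telecomKernel α H) →
        ¬ MaxAssociable.{u} α P X) := by
  refine ⟨fun E _ _ _ _ ν _ _ G N hGm hX _ hN hG => ⟨fun h => ?_, fun ⟨f, c, A, h⟩ => ?_⟩,
    fun H a b _ _ hH hab hX => lfsm_not_maxAssociable hα0 hα2 hH hab hX,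
    fun H _ _ _ hX => telecom_not_maxAssociable hα0 hα2 hX⟩
  · exact exists_indicator_of_maxAssociable hα0 hα2 hX hG h
  · have hm : ∀ t, Measurable (incrementKernel G t) := fun t =>
      (hGm.comp (measurable_fst.prodMk (measurable_snd.const_add t))).sub hGm
    exact maxAssociable_of_ae_mul_nonneg hα0 hm hX (incrementKernel_mul_nonneg hN h)
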